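/- Let $A$ be a complex Banach algebra with identity $\mathbf 1$. For $a,b\in A$ let $C_{a,b}:A\to A$, $C_{a,b}x=ax-xb$, and $$\varrho(a,b)=\limsup_{n}\|C_{a,b}^n\mathbf 1\|^{1/n}.$$ Write $\sigma(a)$ for the spectrum and $r_\sigma(a)$ for the spectral radius of $a$. If $\alpha\in\mathbb C$ is not an accumulation point of $\sigma(a)$, let $p(\alpha,a)=\frac1{2\pi i}\int_{\Gamma_\alpha}(\lambda\mathbf 1-a)^{-1}\,d\lambda$ be the Riesz projection associated with $a$ and $\alpha$, where $\Gamma_\alpha$ is a small positively oriented circle around $\alpha$, disjoint from $\sigma(a)$, that isolates $\alpha$ from the rest of $\sigma(a)$. **Theorem.** Let $a,b\in A$ be such that $\sigma(a)$ and $\sigma(b)$ are infinite and the sets $\sigma(a)\setminus\{0\}$ and $\sigma(b)\setminus\{0\}$ are discrete and have no accumulation point in $\mathbb C$ other than $0$. Let $\lambda_1,\lambda_2,\dots$ and $\beta_1,\beta_2,\dots$ be enumerations without repetition of $\sigma(a)\setminus\{0\}$ and $\sigma(b)\setminus\{0\}$, and put $p_i=p(\lambda_i,a)$, $q_j=p(\beta_j,b)$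 and $$W=\{|\lambda_i-\beta_j| : p_iq_j\neq 0\}.$$ If $W\neq\emptyset$, then $W$ is bounded, the series $\sum_{j=1}^\infty p_kq_j$ converges in $A$ for every $k$ with $|\lambda_k|>\sup W$, the series $\sum_{j=1}^\infty p_jq_k$ converges in $A$ for every $k$ with $|\beta_k|>\sup W$, and, with $$W_\lambda=\Big\{|\lambda_k| : |\lambda_k|>\sup W,\ \sum_{j=1}^\infty p_kq_j\neq p_k\Big\},\qquad W_\beta=\Big\{|\beta_k| : |\beta_k|>\sup W,\ \sum_{j=1}^\infty p_jq_k\neq q_k\Big\},$$ one has $$\varrho(a,b)=\sup\,(W\cup W_\lambda\cup W_\beta).$$ If $W=\emptyset$, then $\varrho(a,b)=\max\{r_\sigma(a),r_\sigma(b)\}$. -/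

import Mathlib

open Filter Topology

namespace SpectralDistance

noncomputable section

variable {A : Type*} [NormedRing A] [NormedAlgebra ℂ A]

/-- The commutator operator `C_{a,b} = L_a - R_b`, i.e. `x ↦ a x - x b`, acting linearly on `A`. -/
def commOp (a b : A) : Module.End ℂ A :=
  LinearMap.mulLeft ℂ a - LinearMap.mulRight ℂ b

/-- `ϱ(a,b) = limsup_n ‖C_{a,b}^n 1‖^{1/n}`. The sequence is bounded, by
`max ‖1‖ 1 * (‖a‖ + ‖b‖)` for `n ≥ 1`, so that this real `limsup` is the usual one. -/
def varrho (a b : A) : ℝ :=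
  limsup (fun n : ℕ => ‖(commOp a b ^ n) 1‖ ^ (1 / (n : ℝ))) atTop

/-- The nonzero spectrum `σ'(a) = σ(a) \ {0}`. -/
def nonzeroSpectrum (a : A) : Set ℂ := spectrum ℂ a \ {0}

/-- `σ'(a)` clusters at `0`, if anywhere. In particular no point of `σ'(a)` is an accumulation
point of `σ'(a)`, i.e. `σ'(a)` is discrete. -/
def ClustersOnlyAtZero (a : A) : Prop :=
  ∀ z : ℂ, AccPt z (𝓟 (nonzeroSpectrum a)) → z = 0

/-- The circle with centre `α` and radius `r` is disjoint from `σ(a)` and isolates `α` from the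
remaining spectrum of `a`. -/
def IsIsolatingRadius (α : ℂ) (a : A) (r : ℝ) : Prop :=
  0 < r ∧ ∀ z ∈ spectrum ℂ a, ‖z - α‖ ≤ r → z = α

open Classical in
/-- The Riesz projection `p(α,a) = (2πi)⁻¹ ∮_{Γ_α} (z 1 - a)⁻¹ dz`, where `Γ_α` is a circle around
`α` isolating `α` from the rest of `σ(a)` (by Cauchy's theorem it does not matter which one).
Default value `0` if there is no such circle, that is, if `α` is an accumulation point of `σ(a)`. -/
def rieszProj (α : ℂ) (a : A) : A :=
  if h : ∃ r : ℝ, IsIsolatingRadius α a r then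
    (2 * (Real.pi : ℂ) * Complex.I)⁻¹ • ∮ z in C(α, h.choose), resolvent a z
  else 0

/-- `W = {|λ_i - β_j| : p_i q_j ≠ 0}`. -/
def setW (a b : A) (lam beta : ℕ → ℂ) : Set ℝ :=
  {x | ∃ i j : ℕ, rieszProj (lam i) a * rieszProj (beta j) b ≠ 0 ∧ x = ‖lam i - beta j‖}

/-- `W_λ = {|λ_k| : |λ_k| > sup W and ∑_j p_k q_j ≠ p_k}`. -/
def setWlam (a b : A) (lam beta : ℕ → ℂ) : Set ℝ :=
  {x | ∃ k : ℕ, sSup (setW a b lam beta) < ‖lam k‖ ∧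
    ∑' j : ℕ, rieszProj (lam k) a * rieszProj (beta j) b ≠ rieszProj (lam k) a ∧ x = ‖lam k‖}

/-- `W_β = {|β_k| : |β_k| > sup W and ∑_j p_j q_k ≠ q_k}`. -/
def setWbeta (a b : A) (lam beta : ℕ → ℂ) : Set ℝ :=
  {x | ∃ k : ℕ, sSup (setW a b lam beta) < ‖beta k‖ ∧
    ∑' j : ℕ, rieszProj (lam j) a * rieszProj (beta k) b ≠ rieszProj (beta k) b ∧ x = ‖beta k‖}

end

end SpectralDistance

/-!
Write `C` for the commutator operator `x ↦ a x - x b`. It commutes with left multiplication by `e`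
and right multiplication by `f` whenever `e` commutes with `a` and `f` with `b`. If moreover
`‖(a - l) ^ n e‖ = O(ρ ^ n)` and `‖(b - m) ^ n f‖ = O(τ ^ n)`, then `C` differs from the scalar
`l - m` on `e A f` by an operator of growth rate at most `ρ + τ`. Hence `C ^ n (e f)` grows at rate
at most `|l - m| + ρ + τ` (`geomBounded_commOp_pow_mul`), and, if `e f ≠ 0`, then
`|l - m| ≤ ϱ(a,b) + ρ + τ` (`norm_sub_le_varrho_add`).

Let `p` and `q` be the sums of the Riesz projections `p_i` with `|λ_i| > r` and `q_j` with
`|β_j| > r`; as the spectra cluster only at `0`, these are finite sums. On `p_i` and `q_j` the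
elements `a - λ_i` and `b - β_j` have arbitrarily small growth rate
(`geomBounded_sub_pow_mul_rieszProj`), and on `1 - p` and `1 - q` the elements `a` and `b` have
growth rate at most any number above `r` (`geomBounded_pow_mul_one_sub_sum`). Splitting `1` into the
blocks `p_i q_j`, `p_i (1 - q)`, `(1 - p) q_j` and `(1 - p) (1 - q)` and letting `r → 0` determines
`ϱ(a,b)` through `|λ_i - β_j|` for the nonzero blocks `p_i q_j`, `|λ_i|` for the blocks `p_i (1 - q)`
that do not vanish, and `|β_j|` for the blocks `(1 - p) q_j` that do not vanish.

If `|λ_k| > sup W`, then `p_k q_j ≠ 0` forces `|β_j| ≥ |λ_k| - sup W > 0`, so that `∑ p_k q_j` is a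
finite sum, equal to `p_k q` for small `r`; thus `p_k (1 - q) ≠ 0` means that `∑ p_k q_j ≠ p_k`. If
`W = ∅`, then `p_k (1 - q) = p_k ≠ 0` for every `k`, and the blocks give the spectral radii.
-/

open Filter Topology

namespace SpectralDistance

/-! ### Geometrically bounded sequences -/

/-- The sequence `u` is `O(τ ^ n)`, with a bound valid for every `n`; in particular the constant
is nonnegative, by the bound for `n = 0`. -/
def GeomBounded {E : Type*} [Norm E] (u : ℕ → E) (τ : ℝ) : Prop :=
  ∃ M : ℝ, ∀ n, ‖u n‖ ≤ M * τ ^ n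

section Growth

variable {E : Type*} [NormedAddCommGroup E]

theorem GeomBounded.exists_nonneg {u : ℕ → E} {τ : ℝ} (h : GeomBounded u τ) :
    ∃ M : ℝ, 0 ≤ M ∧ ∀ n, ‖u n‖ ≤ M * τ ^ n := by
  obtain ⟨M, hM⟩ := h
  exact ⟨M, by simpa using (norm_nonneg _).trans (hM 0), hM⟩

theorem GeomBounded.mono {u : ℕ → E} {τ τ' : ℝ} (h : GeomBounded u τ) (h0 : 0 ≤ τ)
    (hle : τ ≤ τ') : GeomBounded u τ' := by
  obtain ⟨M, hM0, hM⟩ := h.exists_nonneg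
  exact ⟨M, fun n => (hM n).trans (by gcongr)⟩

theorem GeomBounded.add {u v : ℕ → E} {τ : ℝ} (hu : GeomBounded u τ) (hv : GeomBounded v τ) :
    GeomBounded (fun n => u n + v n) τ := by
  obtain ⟨M, hM⟩ := hu
  obtain ⟨M', hM'⟩ := hv
  exact ⟨M + M', fun n => by linarith [norm_add_le (u n) (v n), hM n, hM' n]⟩

theorem GeomBounded.sum {ι : Type*} {u : ι → ℕ → E} {τ : ℝ} (s : Finset ι)
    (h : ∀ i ∈ s, GeomBounded (u i) τ) : GeomBounded (fun n => ∑ i ∈ s, u i n) τ := by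
  choose! M hM using h
  refine ⟨∑ i ∈ s, M i, fun n => ?_⟩
  rw [Finset.sum_mul]
  exact norm_sum_le_of_le s fun i hi => hM i hi n

theorem GeomBounded.zero (τ : ℝ) : GeomBounded (fun _ : ℕ => (0 : E)) τ := ⟨0, fun n => by simp⟩

theorem geomBounded_of_eventually_root_le {u : ℕ → E} {τ : ℝ} (hτ : 0 < τ)
    (h : ∀ᶠ n : ℕ in atTop, ‖u n‖ ^ (1 / (n : ℝ)) ≤ τ) : GeomBounded u τ := by
  obtain ⟨N, hN⟩ := eventually_atTop.1 h
  refine ⟨1 + ∑ n ∈ Finset.range (N + 1), ‖u n‖ / τ ^ n, fun n => ?_⟩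
  have hnn : ∀ m ∈ Finset.range (N + 1), 0 ≤ ‖u m‖ / τ ^ m := fun m _ => by positivity
  have hpow : 0 < τ ^ n := by positivity
  rcases lt_or_ge n (N + 1) with hn | hn
  · have := Finset.single_le_sum hnn (Finset.mem_range.2 hn)
    rw [← div_le_iff₀ hpow]
    linarith
  -- The finite sum also covers `n = 0`, where the exponent `1 / n` has the junk value `0`.
  · have hn0 : n ≠ 0 := by omega
    have h1 := pow_le_pow_left₀ (by positivity) (hN n (by omega)) n
    rw [one_div, Real.rpow_inv_natCast_pow (norm_nonneg _) hn0] at h1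
    have := Finset.sum_nonneg hnn
    nlinarith

/-- The roots `‖u n‖ ^ (1 / n)` of `u = O(τ ^ n)` are dominated by a sequence tending to `τ`. -/
theorem GeomBounded.exists_tendsto {u : ℕ → E} {τ : ℝ} (hτ : 0 ≤ τ) (h : GeomBounded u τ) :
    ∃ v : ℕ → ℝ, Tendsto v atTop (𝓝 τ) ∧ ∀ᶠ n : ℕ in atTop, ‖u n‖ ^ (1 / (n : ℝ)) ≤ v n := by
  obtain ⟨M, hM0, hM⟩ := h.exists_nonneg
  refine ⟨fun n => (M + 1) ^ (1 / (n : ℝ)) * τ, ?_, ?_⟩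
  · have : Tendsto (fun n : ℕ => (M + 1) ^ (1 / (n : ℝ))) atTop (𝓝 1) := by
      have h1 := tendsto_one_div_atTop_nhds_zero_nat (𝕜 := ℝ)
      have h2 := (Real.continuous_const_rpow (a := M + 1) (by positivity)).tendsto 0
      simpa [Function.comp_def] using h2.comp h1
    simpa using this.mul_const τ
  · filter_upwards [eventually_ge_atTop 1] with n hn
    have h1 : ‖u n‖ ≤ (M + 1) * τ ^ n := (hM n).trans (by gcongr; linarith)
    calc ‖u n‖ ^ (1 / (n : ℝ)) ≤ ((M + 1) * τ ^ n) ^ (1 / (n : ℝ)) := by gcongr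
      _ = (M + 1) ^ (1 / (n : ℝ)) * τ := by
        rw [Real.mul_rpow (by positivity) (by positivity), one_div,
          Real.pow_rpow_inv_natCast hτ (by omega)]

theorem GeomBounded.isBoundedUnder {u : ℕ → E} {τ : ℝ} (hτ : 0 ≤ τ) (h : GeomBounded u τ) :
    IsBoundedUnder (· ≤ ·) atTop fun n : ℕ => ‖u n‖ ^ (1 / (n : ℝ)) := by
  obtain ⟨v, hv, hle⟩ := h.exists_tendsto hτ
  exact hv.isBoundedUnder_le.mono_le hle

theorem GeomBounded.limsup_le {u : ℕ → E} {τ : ℝ} (hτ : 0 ≤ τ) (h : GeomBounded u τ) :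
    limsup (fun n : ℕ => ‖u n‖ ^ (1 / (n : ℝ))) atTop ≤ τ := by
  obtain ⟨v, hv, hle⟩ := h.exists_tendsto hτ
  rw [← hv.limsup_eq]
  exact limsup_le_limsup hle
    (isBoundedUnder_of ⟨0, fun n => by positivity⟩ :
      IsBoundedUnder (· ≥ ·) atTop _).isCoboundedUnder_le
    hv.isBoundedUnder_le

variable [NormedSpace ℂ E]

/-- Binomial estimate: a bound `‖P ^ i (Q ^ j x)‖ ≤ M ρ ^ i τ ^ j` for commuting `P` and `Q` gives
`‖(P + Q) ^ n x‖ ≤ M (ρ + τ) ^ n`. -/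
theorem norm_add_pow_apply_le {P Q : Module.End ℂ E} (hPQ : Commute P Q) {x : E} {M ρ τ : ℝ}
    (h : ∀ i j, ‖(P ^ i) ((Q ^ j) x)‖ ≤ M * (ρ ^ i * τ ^ j)) (n : ℕ) :
    ‖((P + Q) ^ n) x‖ ≤ M * (ρ + τ) ^ n := by
  rw [hPQ.add_pow, LinearMap.sum_apply, add_pow, Finset.mul_sum]
  refine norm_sum_le_of_le _ fun i _ => ?_
  rw [← nsmul_eq_mul', LinearMap.smul_apply, Module.End.mul_apply]
  refine (norm_nsmul_le).trans ?_
  calc _ ≤ (n.choose i : ℝ) * (M * (ρ ^ i * τ ^ (n - i))) := by gcongr; exact h i (n - i)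
    _ = _ := by ring

end Growth

/-! ### Growth of the commutator operator on blocks -/

section Commutator

variable {A : Type*} [NormedRing A] [NormedAlgebra ℂ A]

theorem commute_mulLeft_mulRight (a b : A) :
    Commute (LinearMap.mulLeft ℂ a) (LinearMap.mulRight ℂ b) := by
  ext x; simp [mul_assoc]

theorem commOp_eq_shift (a b : A) (l m : ℂ) :
    commOp a b = commOp (a - algebraMap ℂ A l) (b - algebraMap ℂ A m) +
      algebraMap ℂ (Module.End ℂ A) (l - m) := by
  ext x
  simp only [commOp, LinearMap.sub_apply, LinearMap.add_apply, LinearMap.mulLeft_apply,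
    LinearMap.mulRight_apply, LinearMap.smul_apply, Module.End.one_apply, sub_mul, mul_sub,
    sub_smul,
    Algebra.algebraMap_eq_smul_one, smul_mul_assoc, mul_smul_comm, one_mul, mul_one]
  abel

theorem commOp_pow_mul_mul {a b e f : A} (he : Commute a e) (hf : Commute b f) (n : ℕ) (x : A) :
    (commOp a b ^ n) (e * x * f) = e * (commOp a b ^ n) x * f := by
  induction n generalizing x with
  | zero => simp
  | succ n ih =>
    have : commOp a b (e * x * f) = e * commOp a b x * f := by
      simp only [commOp, LinearMap.sub_apply, LinearMap.mulLeft_apply, LinearMap.mulRight_apply,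
        mul_sub, sub_mul]
      rw [← mul_assoc, ← mul_assoc, he.eq, mul_assoc (e * x) f b, ← hf.eq]
      simp only [mul_assoc]
    rw [pow_succ, Module.End.mul_apply, Module.End.mul_apply, this, ih]

theorem exists_norm_commOp_pow_mul_mul_le {a b e f : A} {ρ τ : ℝ} (hf : Commute b f)
    (hρ : GeomBounded (fun n => a ^ n * e) ρ) (hτ : GeomBounded (fun n => b ^ n * f) τ) :
    ∃ M, 0 ≤ M ∧ ∀ x n, ‖(commOp a b ^ n) (e * x * f)‖ ≤ M * ‖x‖ * (ρ + τ) ^ n := by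
  obtain ⟨M, hM0, hM⟩ := hρ.exists_nonneg
  obtain ⟨M', hM'0, hM'⟩ := hτ.exists_nonneg
  refine ⟨M * M', by positivity, fun x n => ?_⟩
  rw [commOp, sub_eq_add_neg]
  refine norm_add_pow_apply_le (commute_mulLeft_mulRight a b).neg_right (fun i j => ?_) n
  have h1 : ‖(LinearMap.mulLeft ℂ a ^ i) (((-LinearMap.mulRight ℂ b) ^ j) (e * x * f))‖ =
      ‖(a ^ i * e) * x * (b ^ j * f)‖ := by
    rw [neg_pow, Module.End.mul_apply, LinearMap.pow_mulRight, LinearMap.pow_mulLeft,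
      LinearMap.mulRight_apply, (hf.pow_left j).eq, LinearMap.mulLeft_apply]
    rcases neg_one_pow_eq_or (Module.End ℂ A) j with h | h <;> simp [h, mul_assoc]
  rw [h1]
  calc ‖(a ^ i * e) * x * (b ^ j * f)‖ ≤ ‖a ^ i * e‖ * ‖x‖ * ‖b ^ j * f‖ := norm_mul₃_le
    _ ≤ (M * ρ ^ i) * ‖x‖ * (M' * τ ^ j) :=
      mul_le_mul (mul_le_mul_of_nonneg_right (hM i) (norm_nonneg _)) (hM' j) (norm_nonneg _)
        (mul_nonneg ((norm_nonneg _).trans (hM i)) (norm_nonneg _))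
    _ = _ := by ring

/-- If `a - l` has growth rate `ρ` on `e` and `b - m` has growth rate `τ` on `f`, then `C_{a,b}` has
growth rate at most `|l - m| + ρ + τ` at `e f`. -/
theorem geomBounded_commOp_pow_mul {a b e f : A} {l m : ℂ} {ρ τ : ℝ} (hf : Commute b f)
    (hρ : GeomBounded (fun n => (a - algebraMap ℂ A l) ^ n * e) ρ)
    (hτ : GeomBounded (fun n => (b - algebraMap ℂ A m) ^ n * f) τ) :
    GeomBounded (fun n => (commOp a b ^ n) (e * f)) (ρ + τ + ‖l - m‖) := by
  have hf' : Commute (b - algebraMap ℂ A m) f := hf.sub_left (Algebra.commute_algebraMap_left m f)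
  obtain ⟨M, hM0, hM⟩ := exists_norm_commOp_pow_mul_mul_le hf' hρ hτ
  refine ⟨M * ‖(1 : A)‖, fun n => ?_⟩
  rw [commOp_eq_shift a b l m]
  refine norm_add_pow_apply_le (Algebra.commute_algebraMap_right _ _) (fun i j => ?_) n
  rw [← map_pow, Module.algebraMap_end_apply, map_smul, norm_smul, norm_pow]
  have := hM 1 i
  rw [mul_one] at this
  nlinarith [mul_le_mul_of_nonneg_left this (pow_nonneg (norm_nonneg (l - m)) j)]

theorem geomBounded_commOp_pow_one (a b : A) :
    GeomBounded (fun n => (commOp a b ^ n) 1) (‖a‖ + ‖b‖) := by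
  have h : ∀ c : A, GeomBounded (fun n => (c - algebraMap ℂ A 0) ^ n * 1) ‖c‖ := by
    refine fun c => ⟨max ‖(1 : A)‖ 1, fun n => ?_⟩
    rcases Nat.eq_zero_or_pos n with rfl | hn
    · simp
    · simpa using (norm_pow_le' c hn).trans
        (le_mul_of_one_le_left (by positivity) (le_max_right _ _))
  simpa using geomBounded_commOp_pow_mul (Commute.one_right b) (h a) (h b)

theorem varrho_nonneg (a b : A) : 0 ≤ varrho a b := by
  refine le_limsup_of_frequently_le (Frequently.of_forall fun n => by positivity) ?_
  exact (geomBounded_commOp_pow_one a b).isBoundedUnder (by positivity)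

theorem geomBounded_of_varrho_lt {a b : A} {t : ℝ} (h : varrho a b < t) :
    GeomBounded (fun n => (commOp a b ^ n) 1) t := by
  refine geomBounded_of_eventually_root_le ((varrho_nonneg a b).trans_lt h) ?_
  have := eventually_lt_of_limsup_lt h
    ((geomBounded_commOp_pow_one a b).isBoundedUnder (by positivity))
  exact this.mono fun n hn => hn.le

theorem eq_zero_of_geomBounded_smul {E : Type*} [NormedAddCommGroup E] {x : E} {s t C : ℝ}
    (ht : 0 ≤ t) (hts : t < s) (h : ∀ n : ℕ, s ^ n * ‖x‖ ≤ C * t ^ n) : x = 0 := by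
  have hs : 0 < s := ht.trans_lt hts
  have hlim : Tendsto (fun n : ℕ => C * (t / s) ^ n) atTop (𝓝 (C * 0)) :=
    (tendsto_pow_atTop_nhds_zero_of_lt_one (by positivity) ((div_lt_one hs).2 hts)).const_mul C
  have hle : ‖x‖ ≤ C * 0 := ge_of_tendsto' hlim fun n => by
    rw [div_pow, ← mul_div_assoc, le_div_iff₀ (by positivity), mul_comm]
    exact h n
  exact norm_le_zero_iff.1 (by simpa using hle)

/-- A nonzero product `e f` of elements on which `a - l` and `b - m` have small growth rates forces
`ϱ(a,b)` to be at least almost `|l - m|`: on `e f` the scalar `l - m` is the sum of `C_{a,b}` and of an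
operator of growth rate at most `ρ + τ`. -/
theorem norm_sub_le_varrho_add {a b e f : A} {l m : ℂ} {ρ τ : ℝ} (he : Commute a e)
    (hf : Commute b f) (hρ0 : 0 ≤ ρ) (hτ0 : 0 ≤ τ)
    (hρ : GeomBounded (fun n => (a - algebraMap ℂ A l) ^ n * e) ρ)
    (hτ : GeomBounded (fun n => (b - algebraMap ℂ A m) ^ n * f) τ) (hne : e * f ≠ 0) :
    ‖l - m‖ ≤ varrho a b + ρ + τ := by
  by_contra! hlt
  obtain ⟨t, ht1, ht2⟩ := exists_between (show varrho a b < ‖l - m‖ - ρ - τ by linarith)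
  have ht0 := (varrho_nonneg a b).trans ht1.le
  obtain ⟨C, hC0, hC⟩ := (geomBounded_of_varrho_lt ht1).exists_nonneg
  have hf' : Commute (b - algebraMap ℂ A m) f := hf.sub_left (Algebra.commute_algebraMap_left m f)
  obtain ⟨M, hM0, hM⟩ := exists_norm_commOp_pow_mul_mul_le hf' hρ hτ
  set N := commOp (a - algebraMap ℂ A l) (b - algebraMap ℂ A m) with hN
  have hshift : algebraMap ℂ (Module.End ℂ A) (l - m) = -N + commOp a b := by
    rw [commOp_eq_shift a b l m]; abel
  have hcomm : Commute (-N) (commOp a b) := by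
    rw [commOp_eq_shift a b l m]
    exact ((Commute.refl N).add_right (Algebra.commute_algebraMap_right _ _)).neg_left
  refine hne (eq_zero_of_geomBounded_smul (t := ρ + τ + t) (C := M * C) (by linarith)
    (show ρ + τ + t < ‖l - m‖ by linarith) fun n => ?_)
  have key := norm_add_pow_apply_le (x := e * f) (M := M * C) (ρ := ρ + τ) (τ := t) hcomm
    (fun i j => ?_) n
  · rwa [← hshift, ← map_pow, Module.algebraMap_end_apply, norm_smul, norm_pow] at key
  · have h1 : (commOp a b ^ j) (e * f) = e * (commOp a b ^ j) 1 * f := by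
      simpa using commOp_pow_mul_mul he hf j 1
    have h2 : ∀ y, ‖((-N) ^ i) y‖ = ‖(N ^ i) y‖ := fun y => by
      rw [neg_pow, Module.End.mul_apply]
      rcases neg_one_pow_eq_or (Module.End ℂ A) i with h | h <;> simp [h]
    rw [h1, h2]
    calc _ ≤ M * ‖(commOp a b ^ j) 1‖ * (ρ + τ) ^ i := hM _ i
      _ ≤ M * (C * t ^ j) * (ρ + τ) ^ i := by gcongr; exact hC j
      _ = _ := by ring

end Commutator

/-! ### Riesz projections -/

section Riesz

variable {A : Type*} [NormedRing A] [NormedAlgebra ℂ A]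

theorem mul_resolvent {a : A} {w : ℂ} (hw : w ∈ resolventSet ℂ a) (z : ℂ) :
    (algebraMap ℂ A z - a) * resolvent a w = 1 - (w - z) • resolvent a w := by
  have h : (algebraMap ℂ A w - a) * resolvent a w = 1 := Ring.mul_inverse_cancel _ hw
  rw [← h, Algebra.smul_def, ← sub_mul, map_sub]
  congr 1
  abel

theorem commute_resolvent {a x : A} (h : Commute x a) (z : ℂ) : Commute x (resolvent a z) := by
  have hc : Commute x (algebraMap ℂ A z - a) := (Algebra.commute_algebraMap_right z x).sub_right h
  by_cases hu : IsUnit (algebraMap ℂ A z - a)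
  · obtain ⟨u, hu⟩ := hu
    rw [resolvent, ← hu, Ring.inverse_unit]
    rw [← hu] at hc
    exact hc.units_inv_right
  · rw [resolvent, Ring.inverse_non_unit _ hu]
    exact Commute.zero_right x

theorem IsIsolatingRadius.mono {α : ℂ} {a : A} {r s : ℝ} (h : IsIsolatingRadius α a r)
    (hs : 0 < s) (hsr : s ≤ r) : IsIsolatingRadius α a s :=
  ⟨hs, fun z hz hle => h.2 z hz (hle.trans hsr)⟩

theorem IsIsolatingRadius.mem_resolventSet {α z : ℂ} {a : A} {r : ℝ} (h : IsIsolatingRadius α a r)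
    (hz : z ∈ Metric.closedBall α r) (hne : z ≠ α) : z ∈ resolventSet ℂ a := by
  by_contra hn
  exact hne (h.2 z hn (by simpa [dist_eq_norm] using hz))

theorem IsIsolatingRadius.ne_center {α z : ℂ} {a : A} {r : ℝ} (h : IsIsolatingRadius α a r)
    (hz : z ∈ Metric.sphere α r) : z ≠ α := fun heq => by
  rw [heq, Metric.mem_sphere, dist_self] at hz
  exact h.1.ne hz

theorem ClustersOnlyAtZero.exists_isIsolatingRadius {a : A} (ha : ClustersOnlyAtZero a) {α : ℂ}
    (hα : α ≠ 0) : ∃ r, IsIsolatingRadius α a r := by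
  have h1 : ¬ AccPt α (𝓟 (nonzeroSpectrum a)) := fun h => hα (ha α h)
  rw [accPt_iff_frequently, not_frequently] at h1
  obtain ⟨ε, hε, hball⟩ := Metric.eventually_nhds_iff.1
    (h1.and (isOpen_ne.eventually_mem hα))
  refine ⟨ε / 2, half_pos hε, fun z hz hle => ?_⟩
  obtain ⟨h2, h3⟩ := hball (y := z) (by rw [dist_eq_norm]; linarith)
  by_contra hne
  exact h2 ⟨hne, hz, h3⟩

variable [CompleteSpace A]

theorem map_circleIntegral (L : A →L[ℂ] A) {f : ℂ → A} {c : ℂ} {R : ℝ}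
    (hf : CircleIntegrable f c R) : L (∮ z in C(c, R), f z) = ∮ z in C(c, R), L (f z) := by
  simp only [circleIntegral, ← map_smul]
  exact (L.intervalIntegral_comp_comm hf.out).symm

theorem mul_circleIntegral (x : A) {f : ℂ → A} {c : ℂ} {R : ℝ} (hf : CircleIntegrable f c R) :
    x * (∮ z in C(c, R), f z) = ∮ z in C(c, R), x * f z :=
  map_circleIntegral (ContinuousLinearMap.mul ℂ A x) hf

theorem circleIntegral_mul (x : A) {f : ℂ → A} {c : ℂ} {R : ℝ} (hf : CircleIntegrable f c R) :
    (∮ z in C(c, R), f z) * x = ∮ z in C(c, R), f z * x :=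
  map_circleIntegral ((ContinuousLinearMap.mul ℂ A).flip x) hf

theorem commute_circleIntegral {x : A} {f : ℂ → A} (h : ∀ z, Commute x (f z)) (c : ℂ) (R : ℝ) :
    Commute x (∮ z in C(c, R), f z) := by
  by_cases hf : CircleIntegrable f c R
  · rw [Commute, SemiconjBy, mul_circleIntegral x hf, circleIntegral_mul x hf]
    simp only [(h _).eq]
  · rw [circleIntegral.integral_undef hf]
    exact Commute.zero_right x

theorem commute_rieszProj {a x : A} (h : Commute x a) (α : ℂ) : Commute x (rieszProj α a) := by
  rw [rieszProj]
  split_ifs with hr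
  · exact (commute_circleIntegral (commute_resolvent h) _ _).smul_right _
  · exact Commute.zero_right x

theorem differentiableAt_resolvent {a : A} {z : ℂ} (hz : z ∈ resolventSet ℂ a) :
    DifferentiableAt ℂ (resolvent a) z :=
  (spectrum.hasDerivAt_resolvent_const_left hz).differentiableAt

theorem IsIsolatingRadius.continuousOn_sphere {α : ℂ} {a : A} {r : ℝ}
    (h : IsIsolatingRadius α a r) : ContinuousOn (resolvent a) (Metric.sphere α r) := fun _ hz =>
  (differentiableAt_resolvent (h.mem_resolventSet (Metric.sphere_subset_closedBall hz)
    (h.ne_center hz))).continuousAt.continuousWithinAt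

theorem IsIsolatingRadius.circleIntegrable {α : ℂ} {a : A} {r : ℝ}
    (h : IsIsolatingRadius α a r) : CircleIntegrable (resolvent a) α r :=
  h.continuousOn_sphere.circleIntegrable h.1.le

theorem circleIntegral_resolvent_eq {α : ℂ} {a : A} {r s : ℝ} (hr : IsIsolatingRadius α a r)
    (hs : 0 < s) (hsr : s ≤ r) :
    ∮ z in C(α, r), resolvent a z = ∮ z in C(α, s), resolvent a z := by
  have hd : ∀ z ∈ Metric.closedBall α r \ Metric.ball α s, DifferentiableAt ℂ (resolvent a) z := by
    rintro z ⟨hz, hzs⟩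
    refine differentiableAt_resolvent (hr.mem_resolventSet hz ?_)
    rintro rfl
    exact hzs (Metric.mem_ball_self hs)
  refine Complex.circleIntegral_eq_of_differentiable_on_annulus_off_countable hs hsr
    Set.countable_empty (fun z hz => (hd z hz).continuousAt.continuousWithinAt) ?_
  rintro z ⟨⟨hz, hzs⟩, -⟩
  exact hd z ⟨Metric.ball_subset_closedBall hz, fun h => hzs (Metric.ball_subset_closedBall h)⟩

theorem rieszProj_eq {α : ℂ} {a : A} {r : ℝ} (h : IsIsolatingRadius α a r) :
    rieszProj α a = (2 * (Real.pi : ℂ) * Complex.I)⁻¹ • ∮ z in C(α, r), resolvent a z := by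
  have hex : ∃ r, IsIsolatingRadius α a r := ⟨r, h⟩
  rw [rieszProj, dif_pos hex]
  congr 1
  rcases le_total r hex.choose with hle | hle
  · exact circleIntegral_resolvent_eq hex.choose_spec h.1 hle
  · exact (circleIntegral_resolvent_eq h hex.choose_spec.1 hle).symm

/-- By induction from `(a - α) (z - a)⁻¹ = (z - α) (z - a)⁻¹ - 1`, as `∮ (z - α) ^ n dz = 0`. -/
theorem sub_pow_mul_circleIntegral {α : ℂ} {a : A} {r : ℝ} (h : IsIsolatingRadius α a r) (n : ℕ) :
    (a - algebraMap ℂ A α) ^ n * ∮ z in C(α, r), resolvent a z =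
      ∮ z in C(α, r), (z - α) ^ n • resolvent a z := by
  have hcont : ∀ n : ℕ, ContinuousOn (fun z => (z - α) ^ n) (Metric.sphere α r) :=
    fun n => by fun_prop
  induction n with
  | zero => simp
  | succ n ih =>
    have hint : ∀ n : ℕ, CircleIntegrable (fun z => (z - α) ^ n • resolvent a z) α r := fun n =>
      ((hcont n).smul h.continuousOn_sphere).circleIntegrable h.1.le
    have hone : CircleIntegrable (fun z => (z - α) ^ n • (1 : A)) α r :=
      ((hcont n).smul continuousOn_const).circleIntegrable h.1.le
    have hzero : ∮ z in C(α, r), (z - α) ^ n • (1 : A) = 0 := by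
      rw [circleIntegral.integral_smul_const]
      have := circleIntegral.integral_sub_zpow_of_ne (n := (n : ℤ)) (by omega) α α r
      simp only [zpow_natCast] at this
      rw [this, zero_smul]
    rw [pow_succ', mul_assoc, ih, mul_circleIntegral _ (hint n)]
    have hEq : Set.EqOn (fun z => (a - algebraMap ℂ A α) * ((z - α) ^ n • resolvent a z))
        (fun z => (z - α) ^ (n + 1) • resolvent a z - (z - α) ^ n • (1 : A))
        (Metric.sphere α r) := fun z hz => by
      have hz' := h.mem_resolventSet (Metric.sphere_subset_closedBall hz) (h.ne_center hz)
      have := mul_resolvent hz' α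
      rw [← neg_sub, neg_mul, neg_eq_iff_eq_neg, neg_sub] at this
      simp only [mul_smul_comm]
      rw [this, smul_sub, smul_smul, pow_succ]
    rw [circleIntegral.integral_congr h.1.le hEq, circleIntegral.integral_sub (hint _) hone, hzero,
      sub_zero]

/-- `a - α` is quasinilpotent on the range of the Riesz projection: on a circle of radius `ε` the
integrand of `(a - α) ^ n p = (2πi)⁻¹ ∮ (z - α) ^ n (z - a)⁻¹ dz` is `O(ε ^ n)`. -/
theorem geomBounded_sub_pow_mul_rieszProj {α : ℂ} {a : A} {r ε : ℝ} (h : IsIsolatingRadius α a r)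
    (hε : 0 < ε) : GeomBounded (fun n => (a - algebraMap ℂ A α) ^ n * rieszProj α a) ε := by
  have hδ : 0 < min r ε := lt_min h.1 hε
  have h' := h.mono hδ (min_le_left _ _)
  suffices GeomBounded (fun n => (a - algebraMap ℂ A α) ^ n * rieszProj α a) (min r ε) from
    this.mono hδ.le (min_le_right _ _)
  obtain ⟨C, hC⟩ := (isCompact_sphere α (min r ε)).exists_bound_of_continuousOn
    h'.continuousOn_sphere
  refine ⟨min r ε * C, fun n => ?_⟩
  dsimp only
  rw [rieszProj_eq h', mul_smul_comm, sub_pow_mul_circleIntegral h', mul_assoc (min r ε) C]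
  refine circleIntegral.norm_two_pi_i_inv_smul_integral_le_of_norm_le_const
    (f := fun z => (z - α) ^ n • resolvent a z) hδ.le fun z hz => ?_
  rw [norm_smul, norm_pow, mem_sphere_iff_norm.1 hz, mul_comm]
  exact mul_le_mul_of_nonneg_right (hC z hz) (by positivity)

/-- The Cauchy transform of the resolvent over the circle `|w - α| = r`. Inside the circle it
continues `z ↦ (z - a)⁻¹ (1 - p)` analytically across `α`. -/
noncomputable def cauchyResolvent (α : ℂ) (r : ℝ) (a : A) (z : ℂ) : A :=
  (2 * (Real.pi : ℂ) * Complex.I)⁻¹ • ∮ w in C(α, r), (w - z)⁻¹ • resolvent a w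

theorem commute_cauchyResolvent {a x : A} (h : Commute x a) (α z : ℂ) (r : ℝ) :
    Commute x (cauchyResolvent α r a z) :=
  (commute_circleIntegral (fun w => (commute_resolvent h w).smul_right _) _ _).smul_right _

theorem differentiableOn_cauchyResolvent {α : ℂ} {a : A} {r : ℝ} (h : IsIsolatingRadius α a r) :
    DifferentiableOn ℂ (cauchyResolvent α r a) (Metric.ball α r) := by
  lift r to NNReal using h.1.le
  have := (hasFPowerSeriesOn_cauchy_integral h.circleIntegrable h.1).differentiableOn
  rwa [Metric.eball_coe] at this

theorem mul_cauchyResolvent {α z : ℂ} {a : A} {r : ℝ} (h : IsIsolatingRadius α a r)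
    (hz : z ∈ Metric.ball α r) :
    (algebraMap ℂ A z - a) * cauchyResolvent α r a z = 1 - rieszProj α a := by
  have hne : ∀ w ∈ Metric.sphere α r, w - z ≠ 0 := fun w hw h0 => by
    rw [sub_eq_zero.1 h0, Metric.mem_sphere] at hw
    exact (Metric.mem_ball.1 hz).ne hw
  have hinv : ContinuousOn (fun w => (w - z)⁻¹) (Metric.sphere α r) :=
    (continuousOn_id.sub continuousOn_const).inv₀ hne
  have hint : CircleIntegrable (fun w => (w - z)⁻¹ • resolvent a w) α r :=
    (hinv.smul h.continuousOn_sphere).circleIntegrable h.1.le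
  have hone : CircleIntegrable (fun w => (w - z)⁻¹ • (1 : A)) α r :=
    (hinv.smul continuousOn_const).circleIntegrable h.1.le
  have hEq : Set.EqOn (fun w => (algebraMap ℂ A z - a) * ((w - z)⁻¹ • resolvent a w))
      (fun w => (w - z)⁻¹ • (1 : A) - resolvent a w) (Metric.sphere α r) := fun w hw => by
    have hw' := h.mem_resolventSet (Metric.sphere_subset_closedBall hw) (h.ne_center hw)
    simp only [mul_smul_comm]
    rw [mul_resolvent hw', smul_sub, smul_smul, inv_mul_cancel₀ (hne w hw), one_smul]
  rw [cauchyResolvent, mul_smul_comm, mul_circleIntegral _ hint,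
    circleIntegral.integral_congr h.1.le hEq, circleIntegral.integral_sub hone h.circleIntegrable,
    circleIntegral.integral_smul_const, circleIntegral.integral_sub_inv_of_mem_ball hz, smul_sub,
    smul_smul, inv_mul_cancel₀ Complex.two_pi_I_ne_zero, one_smul, rieszProj_eq h]

/-- If `p = 0`, then the Cauchy transform at `α` would be an inverse of `α - a`. -/
theorem rieszProj_ne_zero {α : ℂ} {a : A} {r : ℝ} (h : IsIsolatingRadius α a r)
    (hα : α ∈ spectrum ℂ a) : rieszProj α a ≠ 0 := by
  intro h0
  have h1 := mul_cauchyResolvent h (Metric.mem_ball_self h.1)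
  rw [h0, sub_zero] at h1
  have hc : Commute (algebraMap ℂ A α - a) (cauchyResolvent α r a α) :=
    (Algebra.commute_algebraMap_left _ _).sub_left (commute_cauchyResolvent (Commute.refl a) _ _ _)
  exact hα (isUnit_iff_exists.2 ⟨_, h1, hc.eq ▸ h1⟩)

theorem isIdempotentElem_rieszProj {α : ℂ} {a : A} {r : ℝ} (h : IsIsolatingRadius α a r) :
    IsIdempotentElem (rieszProj α a) := by
  have hr2 : r / 2 < r := half_lt_self h.1
  have h' := h.mono (half_pos h.1) hr2.le
  -- On the smaller circle `(z - a)⁻¹ (1 - p)` agrees with a function analytic in the disc.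
  have hzero : rieszProj α a * (1 - rieszProj α a) = 0 := by
    nth_rewrite 1 [rieszProj_eq h']
    have hEq : Set.EqOn (fun z => resolvent a z * (1 - rieszProj α a)) (cauchyResolvent α r a)
        (Metric.sphere α (r / 2)) := fun z hz => by
      have hz' := h'.mem_resolventSet (Metric.sphere_subset_closedBall hz) (h'.ne_center hz)
      have hzb : z ∈ Metric.ball α r := Metric.sphere_subset_ball hr2 hz
      show resolvent a z * (1 - rieszProj α a) = _
      rw [← mul_cauchyResolvent h hzb, ← mul_assoc]
      have : resolvent a z * (algebraMap ℂ A z - a) = 1 := Ring.inverse_mul_cancel _ hz'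
      rw [this, one_mul]
    have hd := differentiableOn_cauchyResolvent h
    rw [smul_mul_assoc, circleIntegral_mul _ h'.circleIntegrable,
      circleIntegral.integral_congr h'.1.le hEq,
      Complex.circleIntegral_eq_zero_of_differentiable_on_off_countable h'.1.le Set.countable_empty
        (hd.continuousOn.mono (Metric.closedBall_subset_ball hr2))
        (fun z hz => hd.differentiableAt
          (Metric.isOpen_ball.mem_nhds (Metric.ball_subset_ball hr2.le hz.1))), smul_zero]
  rw [mul_sub, mul_one, sub_eq_zero] at hzero
  exact hzero.symm

/-- Riesz projections at distinct points annihilate each other, as `a` cannot be close to two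
different scalars on the range of their product. -/
theorem rieszProj_mul_rieszProj {α β : ℂ} {a : A} {r s : ℝ} (hα : IsIsolatingRadius α a r)
    (hβ : IsIsolatingRadius β a s) (hne : α ≠ β) : rieszProj α a * rieszProj β a = 0 := by
  have hpos : 0 < ‖α - β‖ := norm_pos_iff.2 (sub_ne_zero.2 hne)
  -- Any growth rate below `|α - β| / 2` for both factors contradicts `α - β = (a - β) - (a - α)`.
  have hε : 0 < ‖α - β‖ / 4 := by positivity
  obtain ⟨M, hM0, hM⟩ := (geomBounded_sub_pow_mul_rieszProj hα hε).exists_nonneg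
  obtain ⟨M', hM'0, hM'⟩ := (geomBounded_sub_pow_mul_rieszProj hβ hε).exists_nonneg
  set u := a - algebraMap ℂ A α with hu
  set v := a - algebraMap ℂ A β with hv
  have huv : Commute v u :=
    ((Commute.refl a).sub_left (Algebra.commute_algebraMap_left _ _)).sub_right
      (Algebra.commute_algebraMap_right _ _)
  have hpv : Commute v (rieszProj α a) := commute_rieszProj
    ((Commute.refl a).sub_left (Algebra.commute_algebraMap_left _ _)) α
  have hcomm : Commute (-LinearMap.mulLeft ℂ u) (LinearMap.mulLeft ℂ v) := by
    refine Commute.neg_left ?_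
    ext x
    simp [← mul_assoc, huv.eq]
  have hsum : algebraMap ℂ (Module.End ℂ A) (α - β) =
      -LinearMap.mulLeft ℂ u + LinearMap.mulLeft ℂ v := by
    ext x
    simp only [LinearMap.add_apply, LinearMap.neg_apply,
      LinearMap.mulLeft_apply, hu, hv, sub_mul, sub_smul, Algebra.algebraMap_eq_smul_one,
      smul_mul_assoc, one_mul, LinearMap.sub_apply, LinearMap.smul_apply, Module.End.one_apply]
    abel
  refine eq_zero_of_geomBounded_smul (s := ‖α - β‖) (t := ‖α - β‖ / 4 + ‖α - β‖ / 4) (C := M * M')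
    (by positivity) (by linarith) fun n => ?_
  have key := norm_add_pow_apply_le (x := rieszProj α a * rieszProj β a) (M := M * M') hcomm
    (ρ := ‖α - β‖ / 4) (τ := ‖α - β‖ / 4) (fun i j => ?_) n
  · rwa [← hsum, ← map_pow, Module.algebraMap_end_apply, norm_smul, norm_pow] at key
  · have h1 : ‖((-LinearMap.mulLeft ℂ u) ^ i) ((LinearMap.mulLeft ℂ v ^ j)
        (rieszProj α a * rieszProj β a))‖ =
          ‖(u ^ i * rieszProj α a) * (v ^ j * rieszProj β a)‖ := by
      rw [neg_pow, Module.End.mul_apply, LinearMap.pow_mulLeft, LinearMap.pow_mulLeft,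
        LinearMap.mulLeft_apply, LinearMap.mulLeft_apply, ← mul_assoc (v ^ j),
        (hpv.pow_left j).eq]
      rcases neg_one_pow_eq_or (Module.End ℂ A) i with h | h <;> simp [h, mul_assoc]
    rw [h1]
    calc _ ≤ ‖u ^ i * rieszProj α a‖ * ‖v ^ j * rieszProj β a‖ := norm_mul_le _ _
      _ ≤ (M * (‖α - β‖ / 4) ^ i) * (M' * (‖α - β‖ / 4) ^ j) := by
        gcongr
        exacts [hM i, hM' j]
      _ = _ := by ring

theorem orthogonalIdempotents_rieszProj {ι : Type*} {a : A} {lam : ι → ℂ}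
    (hinj : Function.Injective lam) (hiso : ∀ i, ∃ r, IsIsolatingRadius (lam i) a r) :
    OrthogonalIdempotents fun i => rieszProj (lam i) a where
  idem i := isIdempotentElem_rieszProj (hiso i).choose_spec
  ortho _ _ hij := rieszProj_mul_rieszProj (hiso _).choose_spec (hiso _).choose_spec (hinj.ne hij)

theorem geomBounded_pow_of_spectrum_subset {x : A} {r τ : ℝ}
    (h : ∀ z ∈ spectrum ℂ x, ‖z‖ ≤ r) (hr : 0 ≤ r) (hτ : r < τ) :
    GeomBounded (fun n => x ^ n) τ := by
  have hrad : spectralRadius ℂ x ≤ ENNReal.ofReal r :=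
    iSup₂_le fun z hz => by
      rw [← enorm_eq_nnnorm, ← ofReal_norm]
      exact ENNReal.ofReal_le_ofReal (h z hz)
  have hlt : spectralRadius ℂ x < ENNReal.ofReal τ :=
    hrad.trans_lt ((ENNReal.ofReal_lt_ofReal_iff (hr.trans_lt hτ)).2 hτ)
  refine geomBounded_of_eventually_root_le (hr.trans_lt hτ) ?_
  filter_upwards [(spectrum.pow_norm_pow_one_div_tendsto_nhds_spectralRadius x).eventually_lt_const
    hlt] with n hn
  exact (ENNReal.ofReal_lt_ofReal_iff (hr.trans_lt hτ)).1 hn |>.le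

/-- Removing finitely many isolated points from the spectrum: if `e` is the sum of their Riesz
projections, then `a (1 - e)` has its spectrum in the disc containing the remaining points, and
its growth is given by Gelfand's formula. -/
theorem geomBounded_pow_mul_one_sub_sum {ι : Type*} {a : A} {lam : ι → ℂ}
    (hinj : Function.Injective lam) (hiso : ∀ i, ∃ r, IsIsolatingRadius (lam i) a r)
    {F : Finset ι} {r τ : ℝ} (hr : 0 ≤ r) (hτ : r < τ)
    (hF : ∀ z ∈ spectrum ℂ a, r < ‖z‖ → ∃ i ∈ F, z = lam i) :
    GeomBounded (fun n => a ^ n * (1 - ∑ i ∈ F, rieszProj (lam i) a)) τ := by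
  have horth := orthogonalIdempotents_rieszProj hinj hiso
  set e := ∑ i ∈ F, rieszProj (lam i) a with he
  have hee : IsIdempotentElem e := horth.isIdempotentElem_sum
  have hcomm : ∀ x : A, Commute x a → Commute x e := fun x hx =>
    Commute.sum_right _ _ _ fun i _ => commute_rieszProj hx _
  have hae : Commute a (1 - e) := (Commute.one_right a).sub_right (hcomm a (Commute.refl a))
  have he1 : e * (1 - e) = 0 := by rw [mul_sub, mul_one, hee.eq, sub_self]
  have h1e : (1 - e) * e = 0 := by rw [sub_mul, one_mul, hee.eq, sub_self]
  have h11 : (1 - e) * (1 - e) = 1 - e := hee.one_sub.eq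
  -- Outside the disc, `z - a` is invertible on the range of `1 - e`.
  have hinv : ∀ z : ℂ, r < ‖z‖ → ∃ g : A, Commute g a ∧ (algebraMap ℂ A z - a) * g = 1 - e := by
    intro z hz
    by_cases hza : z ∈ spectrum ℂ a
    · obtain ⟨i, hi, rfl⟩ := hF z hza hz
      obtain ⟨s, hs⟩ := hiso i
      refine ⟨cauchyResolvent (lam i) s a (lam i) * (1 - e), ?_, ?_⟩
      · exact (commute_cauchyResolvent (Commute.refl a) _ _ _).symm.mul_left hae.symm
      · have hpe : rieszProj (lam i) a * e = rieszProj (lam i) a := horth.mul_sum_of_mem hi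
        rw [← mul_assoc, mul_cauchyResolvent hs (Metric.mem_ball_self hs.1), sub_mul, one_mul,
          mul_sub, mul_one, hpe, sub_self, sub_zero]
    · refine ⟨resolvent a z * (1 - e),
        (commute_resolvent (Commute.refl a) z).symm.mul_left hae.symm, ?_⟩
      have : (algebraMap ℂ A z - a) * resolvent a z = 1 :=
        Ring.mul_inverse_cancel _ (not_not.1 hza)
      rw [← mul_assoc, this, one_mul]
  have hspec : ∀ z ∈ spectrum ℂ (a * (1 - e)), ‖z‖ ≤ r := by
    intro z hz
    by_contra! hlt
    have hz0 : z ≠ 0 := fun h0 => by simp [h0] at hlt; linarith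
    obtain ⟨g, hga, hg⟩ := hinv z hlt
    have hge : Commute g e := hcomm g hga
    have hg1 : Commute g (1 - e) := (Commute.one_right g).sub_right hge
    have hx : algebraMap ℂ A z - a * (1 - e) = (algebraMap ℂ A z - a) * (1 - e) + z • e := by
      rw [sub_mul, ← Algebra.smul_def, smul_sub, Algebra.algebraMap_eq_smul_one]; abel
    -- The inverse is `g` on the range of `1 - e`, and `z⁻¹` on the range of `e`.
    have hprod : (algebraMap ℂ A z - a * (1 - e)) * (g * (1 - e) + z⁻¹ • e) = 1 := by
      have t1 : (algebraMap ℂ A z - a) * (1 - e) * (g * (1 - e)) = 1 - e := by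
        rw [mul_assoc, ← mul_assoc (1 - e), ← hg1.eq, mul_assoc g, h11, ← mul_assoc, hg, h11]
      have t2 : (algebraMap ℂ A z - a) * (1 - e) * (z⁻¹ • e) = 0 := by
        rw [mul_smul_comm, mul_assoc, h1e, mul_zero, smul_zero]
      have t3 : (z • e) * (g * (1 - e)) = 0 := by
        rw [smul_mul_assoc, hg1.eq, ← mul_assoc, he1, zero_mul, smul_zero]
      have t4 : (z • e) * (z⁻¹ • e) = e := by
        rw [smul_mul_smul_comm, mul_inv_cancel₀ hz0, hee.eq, one_smul]
      rw [hx, add_mul, mul_add, mul_add, t1, t2, t3, t4]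
      abel
    have hcom : Commute (algebraMap ℂ A z - a * (1 - e)) (g * (1 - e) + z⁻¹ • e) := by
      have c1 : Commute (a * (1 - e)) (g * (1 - e)) :=
        (hga.symm.mul_right hae).mul_left (hg1.symm.mul_right (Commute.refl _))
      have c2 : Commute (a * (1 - e)) (z⁻¹ • e) :=
        ((hcomm a (Commute.refl a)).mul_left (by rw [Commute, SemiconjBy, h1e, he1])).smul_right _
      exact (Algebra.commute_algebraMap_left _ _).sub_left (c1.add_right c2)
    exact hz (isUnit_iff_exists.2 ⟨_, hprod, hcom.eq ▸ hprod⟩)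
  obtain ⟨M, hM⟩ := geomBounded_pow_of_spectrum_subset hspec hr hτ
  refine ⟨M * ‖1 - e‖, fun n => ?_⟩
  have hpow : a ^ n * (1 - e) = (a * (1 - e)) ^ n * (1 - e) := by
    rw [hae.mul_pow, mul_assoc, ← pow_succ, hee.one_sub.pow_succ_eq]
  dsimp only
  rw [hpow]
  calc _ ≤ ‖(a * (1 - e)) ^ n‖ * ‖1 - e‖ := norm_mul_le _ _
    _ ≤ M * τ ^ n * ‖1 - e‖ := by gcongr; exact hM n
    _ = _ := by ring

/-! ### Spectra clustering only at zero -/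

theorem ClustersOnlyAtZero.exists_finset {a : A} (ha : ClustersOnlyAtZero a) {lam : ℕ → ℂ}
    (hinj : Function.Injective lam) (hrange : Set.range lam = nonzeroSpectrum a) {r : ℝ}
    (hr : 0 < r) : ∃ F : Finset ℕ, ∀ i, i ∈ F ↔ r < ‖lam i‖ := by
  have hfin : {i | r < ‖lam i‖}.Finite := by
    by_contra hinf
    have himg : (lam '' {i | r < ‖lam i‖}).Infinite :=
      Set.Infinite.image hinj.injOn hinf
    have hsub : lam '' {i | r < ‖lam i‖} ⊆ nonzeroSpectrum a := by
      rw [← hrange]; exact Set.image_subset_range _ _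
    have hsub' : lam '' {i | r < ‖lam i‖} ⊆ spectrum ℂ a ∩ {z | r ≤ ‖z‖} := by
      rintro _ ⟨i, hi, rfl⟩
      exact ⟨(hsub ⟨i, hi, rfl⟩).1, (Set.mem_ofPred.1 hi).le⟩
    obtain ⟨z, hz, hacc⟩ := himg.exists_accPt_of_subset_isCompact
      ((spectrum.isCompact a).inter_right (isClosed_le continuous_const continuous_norm)) hsub'
    have hz0 := ha z (hacc.mono (principal_mono.2 hsub))
    have : r ≤ ‖z‖ := hz.2
    rw [hz0, norm_zero] at this
    linarith
  exact ⟨hfin.toFinset, fun i => by simp⟩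

end Riesz

section Enumeration

variable {A : Type*} [NormedRing A] [NormedAlgebra ℂ A]

/-- An enumeration without repetition of the nonzero spectrum of `a`, which clusters only at `0`. -/
structure IsSpectralEnumeration (a : A) (lam : ℕ → ℂ) : Prop where
  clusters : ClustersOnlyAtZero a
  injective : Function.Injective lam
  range_eq : Set.range lam = nonzeroSpectrum a

namespace IsSpectralEnumeration

variable {a : A} {lam : ℕ → ℂ} (h : IsSpectralEnumeration a lam)
include h

theorem mem (i : ℕ) : lam i ∈ nonzeroSpectrum a := h.range_eq ▸ Set.mem_range_self i

theorem isolated (i : ℕ) : ∃ r, IsIsolatingRadius (lam i) a r :=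
  h.clusters.exists_isIsolatingRadius (h.mem i).2

variable [CompleteSpace A]

theorem rieszProj_ne_zero (i : ℕ) : rieszProj (lam i) a ≠ 0 :=
  SpectralDistance.rieszProj_ne_zero (h.isolated i).choose_spec (h.mem i).1

theorem geomBounded_rieszProj (i : ℕ) {ε : ℝ} (hε : 0 < ε) :
    GeomBounded (fun n => (a - algebraMap ℂ A (lam i)) ^ n * rieszProj (lam i) a) ε :=
  geomBounded_sub_pow_mul_rieszProj (h.isolated i).choose_spec hε

theorem exists_finset {r : ℝ} (hr : 0 < r) : ∃ F : Finset ℕ, ∀ i, i ∈ F ↔ r < ‖lam i‖ :=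
  h.clusters.exists_finset h.injective h.range_eq hr

theorem geomBounded_one_sub_sum {r : ℝ} (hr : 0 < r) {F : Finset ℕ}
    (hF : ∀ i, i ∈ F ↔ r < ‖lam i‖) :
    GeomBounded (fun n => (a - algebraMap ℂ A 0) ^ n * (1 - ∑ i ∈ F, rieszProj (lam i) a))
      (2 * r) := by
  rw [map_zero, sub_zero]
  refine geomBounded_pow_mul_one_sub_sum h.injective h.isolated hr.le (by linarith) ?_
  intro z hz hzr
  have hz0 : z ≠ 0 := fun h0 => by rw [h0, norm_zero] at hzr; linarith
  have hz' : z ∈ Set.range lam := h.range_eq ▸ ⟨hz, hz0⟩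
  obtain ⟨i, rfl⟩ := hz'
  exact ⟨i, (hF i).2 hzr, rfl⟩

theorem norm_le_spectralRadius (i : ℕ) : ‖lam i‖ ≤ (spectralRadius ℂ a).toReal := by
  obtain ⟨k, -, hk⟩ := spectrum.exists_nnnorm_eq_spectralRadius_of_nonempty ⟨_, (h.mem i).1⟩
  have hle : (‖lam i‖₊ : ENNReal) ≤ spectralRadius ℂ a :=
    le_iSup₂ (f := fun z (_ : z ∈ spectrum ℂ a) => (‖z‖₊ : ENNReal)) (lam i) (h.mem i).1
  simpa using ENNReal.toReal_mono (by simp [← hk]) hle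

theorem spectralRadius_le {S : ℝ} (hS : 0 ≤ S) (hle : ∀ i, ‖lam i‖ ≤ S) :
    (spectralRadius ℂ a).toReal ≤ S := by
  obtain ⟨k, hk, hka⟩ := spectrum.exists_nnnorm_eq_spectralRadius_of_nonempty ⟨_, (h.mem 0).1⟩
  rw [← hka, ENNReal.coe_toReal, coe_nnnorm]
  by_cases hk0 : k = 0
  · simpa [hk0] using hS
  · have hk' : k ∈ Set.range lam := h.range_eq ▸ ⟨hk, hk0⟩
    obtain ⟨i, rfl⟩ := hk'
    exact hle i

end IsSpectralEnumeration

variable [CompleteSpace A]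

theorem commute_one_sub_sum_rieszProj (a : A) (lam : ℕ → ℂ) (F : Finset ℕ) :
    Commute a (1 - ∑ i ∈ F, rieszProj (lam i) a) :=
  (Commute.one_right a).sub_right
    (Commute.sum_right _ _ _ fun _ _ => commute_rieszProj (Commute.refl a) _)

/-! ### Bounds for `ϱ(a,b)` -/

section Bounds

variable {a b : A} {lam beta : ℕ → ℂ} (ha : IsSpectralEnumeration a lam)
  (hb : IsSpectralEnumeration b beta)
include ha hb

theorem norm_sub_le_varrho {i j : ℕ} (hne : rieszProj (lam i) a * rieszProj (beta j) b ≠ 0) :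
    ‖lam i - beta j‖ ≤ varrho a b := by
  refine le_of_forall_pos_le_add fun ε hε => ?_
  have := norm_sub_le_varrho_add (commute_rieszProj (Commute.refl a) _)
    (commute_rieszProj (Commute.refl b) _) (half_pos hε).le (half_pos hε).le
    (ha.geomBounded_rieszProj i (half_pos hε)) (hb.geomBounded_rieszProj j (half_pos hε)) hne
  linarith

/-- If `p_i (1 - q) ≠ 0` for the spectral projections `q` of `b` outside all small discs, then
`ϱ(a,b) ≥ |λ_i|`. -/
theorem norm_left_le_varrho {i : ℕ} {δ : ℝ} (hδ : 0 < δ)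
    (hne : ∀ r, 0 < r → r < δ → ∀ G : Finset ℕ, (∀ j, j ∈ G ↔ r < ‖beta j‖) →
      rieszProj (lam i) a * (1 - ∑ j ∈ G, rieszProj (beta j) b) ≠ 0) :
    ‖lam i‖ ≤ varrho a b := by
  refine le_of_forall_pos_le_add fun ε hε => ?_
  obtain ⟨r, hr0, hr⟩ := exists_between (lt_min hδ (by positivity : 0 < ε / 3))
  obtain ⟨hrδ, hrε⟩ := lt_min_iff.1 hr
  obtain ⟨G, hG⟩ := hb.exists_finset hr0
  have := norm_sub_le_varrho_add (commute_rieszProj (Commute.refl a) _)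
    (commute_one_sub_sum_rieszProj b beta G) hr0.le (by positivity)
    (ha.geomBounded_rieszProj i hr0) (hb.geomBounded_one_sub_sum hr0 hG) (hne r hr0 hrδ G hG)
  rw [sub_zero] at this
  linarith

/-- If `(1 - p) q_j ≠ 0` for the spectral projections `p` of `a` outside all small discs, then
`ϱ(a,b) ≥ |β_j|`. -/
theorem norm_right_le_varrho {j : ℕ} {δ : ℝ} (hδ : 0 < δ)
    (hne : ∀ r, 0 < r → r < δ → ∀ F : Finset ℕ, (∀ i, i ∈ F ↔ r < ‖lam i‖) →
      (1 - ∑ i ∈ F, rieszProj (lam i) a) * rieszProj (beta j) b ≠ 0) :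
    ‖beta j‖ ≤ varrho a b := by
  refine le_of_forall_pos_le_add fun ε hε => ?_
  obtain ⟨r, hr0, hr⟩ := exists_between (lt_min hδ (by positivity : 0 < ε / 3))
  obtain ⟨hrδ, hrε⟩ := lt_min_iff.1 hr
  obtain ⟨F, hF⟩ := ha.exists_finset hr0
  have := norm_sub_le_varrho_add (commute_one_sub_sum_rieszProj a lam F)
    (commute_rieszProj (Commute.refl b) _) (by positivity) hr0.le
    (ha.geomBounded_one_sub_sum hr0 hF) (hb.geomBounded_rieszProj j hr0) (hne r hr0 hrδ F hF)
  rw [zero_sub, norm_neg] at this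
  linarith

/-- Splitting `1 = (p + (1 - p)) (q + (1 - q))`, where `p` and `q` are the spectral projections of
`a` and `b` outside a small disc, bounds `ϱ(a,b)` by the growth rates on the nonzero blocks. -/
theorem varrho_le {S : ℝ} (hS : 0 ≤ S)
    (hpq : ∀ i j, rieszProj (lam i) a * rieszProj (beta j) b ≠ 0 → ‖lam i - beta j‖ ≤ S)
    (hp : ∀ r, 0 < r → ∀ G : Finset ℕ, (∀ j, j ∈ G ↔ r < ‖beta j‖) → ∀ i,
      rieszProj (lam i) a * (1 - ∑ j ∈ G, rieszProj (beta j) b) ≠ 0 → ‖lam i‖ ≤ S + r)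
    (hq : ∀ r, 0 < r → ∀ F : Finset ℕ, (∀ i, i ∈ F ↔ r < ‖lam i‖) → ∀ j,
      (1 - ∑ i ∈ F, rieszProj (lam i) a) * rieszProj (beta j) b ≠ 0 → ‖beta j‖ ≤ S + r) :
    varrho a b ≤ S := by
  refine le_of_forall_pos_le_add fun ε hε => ?_
  -- Every block has growth rate at most `S + 4 r`.
  have hr : 0 < ε / 4 := by positivity
  set r := ε / 4 with hrε
  obtain ⟨F, hF⟩ := ha.exists_finset hr
  obtain ⟨G, hG⟩ := hb.exists_finset hr
  set p := ∑ i ∈ F, rieszProj (lam i) a with hpdef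
  set q := ∑ j ∈ G, rieszProj (beta j) b with hqdef
  have hbq : Commute b (1 - q) := commute_one_sub_sum_rieszProj b beta G
  have hbj : ∀ j, Commute b (rieszProj (beta j) b) := fun j => commute_rieszProj (Commute.refl b) _
  have hap := ha.geomBounded_one_sub_sum hr hF
  have hbG := hb.geomBounded_one_sub_sum hr hG
  have h1 : (1 : A) = ∑ i ∈ F, ∑ j ∈ G, rieszProj (lam i) a * rieszProj (beta j) b +
      ∑ i ∈ F, rieszProj (lam i) a * (1 - q) + ∑ j ∈ G, (1 - p) * rieszProj (beta j) b +
      (1 - p) * (1 - q) := by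
    rw [← Finset.sum_mul_sum, ← Finset.sum_mul, ← Finset.mul_sum, ← hpdef, ← hqdef]
    noncomm_ring
  have hblock : ∀ {x : A} {τ : ℝ}, 0 ≤ τ → (x ≠ 0 → τ ≤ S + ε) →
      GeomBounded (fun n => (commOp a b ^ n) x) τ →
      GeomBounded (fun n => (commOp a b ^ n) x) (S + ε) := by
    intro x τ h0 hle hx
    by_cases hx0 : x = 0
    · simpa [hx0] using GeomBounded.zero _
    · exact hx.mono h0 (hle hx0)
  have hgrowth : GeomBounded (fun n => (commOp a b ^ n) 1) (S + ε) := by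
    rw [h1]
    simp only [map_add, map_sum]
    refine (((GeomBounded.sum F fun i _ => GeomBounded.sum G fun j _ => ?_).add
      (GeomBounded.sum F fun i _ => ?_)).add (GeomBounded.sum G fun j _ => ?_)).add ?_
    · refine hblock (by positivity) (fun hne => ?_) (geomBounded_commOp_pow_mul (hbj j)
        (ha.geomBounded_rieszProj i hr) (hb.geomBounded_rieszProj j hr))
      linarith [hpq i j hne]
    · refine hblock (by positivity) (fun hne => ?_) (geomBounded_commOp_pow_mul hbq
        (ha.geomBounded_rieszProj i hr) hbG)
      rw [sub_zero]
      linarith [hp r hr G hG i hne]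
    · refine hblock (by positivity) (fun hne => ?_) (geomBounded_commOp_pow_mul (hbj j)
        hap (hb.geomBounded_rieszProj j hr))
      rw [zero_sub, norm_neg]
      linarith [hq r hr F hF j hne]
    · refine hblock (by positivity) (fun _ => ?_) (geomBounded_commOp_pow_mul hbq hap hbG)
      rw [sub_zero, norm_zero]
      linarith
  exact hgrowth.limsup_le (by positivity)

theorem bddAbove_setW : BddAbove (setW a b lam beta) := by
  refine ⟨varrho a b, ?_⟩
  rintro _ ⟨i, j, hne, rfl⟩
  exact norm_sub_le_varrho ha hb hne

/-- If `|λ_k| > sup W`, then `p_k q_j ≠ 0` only for `|β_j| ≥ |λ_k| - sup W`, so that the series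
`∑ p_k q_j` is a finite sum. -/
theorem hasSum_left {k : ℕ} {r : ℝ} (hr : r < ‖lam k‖ - sSup (setW a b lam beta))
    {G : Finset ℕ} (hG : ∀ j, j ∈ G ↔ r < ‖beta j‖) :
    HasSum (fun j => rieszProj (lam k) a * rieszProj (beta j) b)
      (rieszProj (lam k) a * ∑ j ∈ G, rieszProj (beta j) b) := by
  rw [Finset.mul_sum]
  refine hasSum_sum_of_ne_finset_zero fun j hj => ?_
  by_contra hne
  have h1 : ‖lam k - beta j‖ ≤ sSup (setW a b lam beta) :=
    le_csSup (bddAbove_setW ha hb) ⟨k, j, hne, rfl⟩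
  have h2 := norm_sub_norm_le (lam k) (beta j)
  exact hj ((hG j).2 (by linarith))

theorem hasSum_right {k : ℕ} {r : ℝ} (hr : r < ‖beta k‖ - sSup (setW a b lam beta))
    {F : Finset ℕ} (hF : ∀ i, i ∈ F ↔ r < ‖lam i‖) :
    HasSum (fun j => rieszProj (lam j) a * rieszProj (beta k) b)
      ((∑ i ∈ F, rieszProj (lam i) a) * rieszProj (beta k) b) := by
  rw [Finset.sum_mul]
  refine hasSum_sum_of_ne_finset_zero fun j hj => ?_
  by_contra hne
  have h1 : ‖lam j - beta k‖ ≤ sSup (setW a b lam beta) :=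
    le_csSup (bddAbove_setW ha hb) ⟨j, k, hne, rfl⟩
  have h2 := norm_sub_norm_le (beta k) (lam j)
  rw [norm_sub_rev] at h2
  exact hj ((hF j).2 (by linarith))

theorem isLUB_varrho (hW : (setW a b lam beta).Nonempty) :
    IsLUB (setW a b lam beta ∪ setWlam a b lam beta ∪ setWbeta a b lam beta) (varrho a b) := by
  constructor
  · rintro x ((⟨i, j, hne, rfl⟩ | ⟨k, hk, hne, rfl⟩) | ⟨k, hk, hne, rfl⟩)
    · exact norm_sub_le_varrho ha hb hne
    · refine norm_left_le_varrho ha hb (sub_pos.2 hk) fun r _ hr G hG h0 => hne ?_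
      rw [(hasSum_left ha hb hr hG).tsum_eq]
      rw [mul_sub, mul_one, sub_eq_zero] at h0
      exact h0.symm
    · refine norm_right_le_varrho ha hb (sub_pos.2 hk) fun r _ hr F hF h0 => hne ?_
      rw [(hasSum_right ha hb hr hF).tsum_eq]
      rw [sub_mul, one_mul, sub_eq_zero] at h0
      exact h0.symm
  · intro S hS
    have hWS : sSup (setW a b lam beta) ≤ S := csSup_le hW fun x hx => hS (Or.inl (Or.inl hx))
    obtain ⟨x, hx⟩ := hW
    have hS0 : 0 ≤ S := by
      have hxS := hS (Or.inl (Or.inl hx))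
      obtain ⟨i, j, -, rfl⟩ := hx
      exact (norm_nonneg _).trans hxS
    refine varrho_le ha hb hS0 (fun i j hne => hS (Or.inl (Or.inl ⟨i, j, hne, rfl⟩))) ?_ ?_
    · intro r hr G hG i hne
      by_contra! hlt
      have hmem : ‖lam i‖ ∈ setWlam a b lam beta := by
        refine ⟨i, by linarith, fun heq => hne ?_, rfl⟩
        rw [(hasSum_left ha hb (by linarith) hG).tsum_eq] at heq
        rw [mul_sub, mul_one, heq, sub_self]
      linarith [hS (Or.inl (Or.inr hmem))]
    · intro r hr F hF j hne
      by_contra! hlt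
      have hmem : ‖beta j‖ ∈ setWbeta a b lam beta := by
        refine ⟨j, by linarith, fun heq => hne ?_, rfl⟩
        rw [(hasSum_right ha hb (by linarith) hF).tsum_eq] at heq
        rw [sub_mul, one_mul, heq, sub_self]
      linarith [hS (Or.inr hmem)]

theorem varrho_eq_max (hW : setW a b lam beta = ∅) :
    varrho a b = max (spectralRadius ℂ a).toReal (spectralRadius ℂ b).toReal := by
  have h0 : ∀ i j, rieszProj (lam i) a * rieszProj (beta j) b = 0 := fun i j => by
    by_contra hne
    exact hW.subset (⟨i, j, hne, rfl⟩ : ‖lam i - beta j‖ ∈ setW a b lam beta)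
  apply le_antisymm
  · refine varrho_le ha hb (le_max_of_le_left ENNReal.toReal_nonneg)
      (fun i j hne => absurd (h0 i j) hne) ?_ ?_
    · intro r hr _ _ i _
      linarith [ha.norm_le_spectralRadius i,
        le_max_left (spectralRadius ℂ a).toReal (spectralRadius ℂ b).toReal]
    · intro r hr _ _ j _
      linarith [hb.norm_le_spectralRadius j,
        le_max_right (spectralRadius ℂ a).toReal (spectralRadius ℂ b).toReal]
  · refine max_le (ha.spectralRadius_le (varrho_nonneg a b) fun i => ?_)
      (hb.spectralRadius_le (varrho_nonneg a b) fun j => ?_)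
    · refine norm_left_le_varrho ha hb one_pos fun r _ _ G _ => ?_
      rw [mul_sub, mul_one, Finset.mul_sum, Finset.sum_eq_zero fun j _ => h0 i j, sub_zero]
      exact ha.rieszProj_ne_zero i
    · refine norm_right_le_varrho ha hb one_pos fun r _ _ F _ => ?_
      rw [sub_mul, one_mul, Finset.sum_mul, Finset.sum_eq_zero fun i _ => h0 i j, sub_zero]
      exact hb.rieszProj_ne_zero j

end Bounds

end Enumeration

end SpectralDistance

theorem theorem2p5 {A : Type*} [NormedRing A] [NormedAlgebra ℂ A] [CompleteSpace A] (a b : A)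
    (ha : SpectralDistance.ClustersOnlyAtZero a) (hb : SpectralDistance.ClustersOnlyAtZero b)
    (ha_inf : (spectrum ℂ a).Infinite) (hb_inf : (spectrum ℂ b).Infinite)
    (lam beta : ℕ → ℂ)
    (hlam : Function.Injective lam)
    (hlam_range : Set.range lam = SpectralDistance.nonzeroSpectrum a)
    (hbeta : Function.Injective beta)
    (hbeta_range : Set.range beta = SpectralDistance.nonzeroSpectrum b) :
    ((SpectralDistance.setW a b lam beta).Nonempty →
      BddAbove (SpectralDistance.setW a b lam beta) ∧
      (∀ k : ℕ, sSup (SpectralDistance.setW a b lam beta) < ‖lam k‖ →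
        Summable fun j : ℕ =>
          SpectralDistance.rieszProj (lam k) a * SpectralDistance.rieszProj (beta j) b) ∧
      (∀ k : ℕ, sSup (SpectralDistance.setW a b lam beta) < ‖beta k‖ →
        Summable fun j : ℕ =>
          SpectralDistance.rieszProj (lam j) a * SpectralDistance.rieszProj (beta k) b) ∧
      IsLUB (SpectralDistance.setW a b lam beta ∪ SpectralDistance.setWlam a b lam beta ∪
          SpectralDistance.setWbeta a b lam beta)
        (SpectralDistance.varrho a b)) ∧
    (SpectralDistance.setW a b lam beta = ∅ →
      SpectralDistance.varrho a b =
        max (spectralRadius ℂ a).toReal (spectralRadius ℂ b).toReal) := by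
  have hea : SpectralDistance.IsSpectralEnumeration a lam := ⟨ha, hlam, hlam_range⟩
  have heb : SpectralDistance.IsSpectralEnumeration b beta := ⟨hb, hbeta, hbeta_range⟩
  refine ⟨fun hW => ⟨SpectralDistance.bddAbove_setW hea heb, fun k hk => ?_, fun k hk => ?_,
    SpectralDistance.isLUB_varrho hea heb hW⟩, SpectralDistance.varrho_eq_max hea heb⟩
  · obtain ⟨r, hr0, hr⟩ := exists_between (sub_pos.2 hk)
    obtain ⟨G, hG⟩ := heb.exists_finset hr0
    exact (SpectralDistance.hasSum_left hea heb hr hG).summable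
  · obtain ⟨r, hr0, hr⟩ := exists_between (sub_pos.2 hk)
    obtain ⟨F, hF⟩ := hea.exists_finset hr0
    exact (SpectralDistance.hasSum_right hea heb hr hF).summable
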